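/- For every $\varepsilon>0$ there is a constant $K$ such that the following holds for every $n\ge 1$. Let $R$ be a semiring (for instance any ring), let $\Gamma$ be a finite alphabet, equipped with an abelian group structure, and let each symbol $\gamma\in\Gamma$ encode an element $\mathrm{val}(\gamma)\in R$. Then there is a quantum query algorithm for \textsc{Matrix Product Verification} making at most $K\,n^{5/3}$ queries: given oracle access to three $n\times n$ matrices $A,B,C$ whose entries are encoded by symbols of $\Gamma$, on every such input it outputs, with probability at least $1-\varepsilon$, a correct answer, that is, either ``accept'' when $AB=C$ in $R$, or, when $AB\ne C$, a pair of indices $(i,j)$ such that $(AB)_{ij}\ne C_{ij}$. Here one query is one application of the unitary $|q,b,w\rangle\mapsto|q,b+x_q,w\rangle$, where $q$ ranges over the $3n^2$ entry positions of the three matrices, $b\in\Gamma$, $x_q\in\Gamma$ is the symbol at position $q$, and $w$ is a basis state of a finite workspace. An algorithm with $T$ queries starts in a fixed basis state, alternates $T+1$ unitaries that do not depend on $A,B,C$ with $T$ queries, measures the final state in the computational basis, and outputs a function of the outcome. In particular, \textsc{Matrix Product Verification} can be solved with high probability in quantum query complexity $O(n^{5/3})$. -/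

import Mathlib

universe u

namespace QuantumQuery

/-- The computational basis of a query algorithm with query positions `Q`, alphabet `Γ` and
workspace `W`: a basis state `|q, b, w⟩` consists of a query register, an answer register and a
workspace register. -/
abbrev BasisState (Q Γ W : Type*) : Type _ := Q × Γ × W

/-- The Hilbert space `ℂ^(Q × Γ × W)` of the algorithm. -/
abbrev StateSpace (Q Γ W : Type*) : Type _ := EuclideanSpace ℂ (BasisState Q Γ W)

/-- The permutation `(q, b, w) ↦ (q, b + x q, w)` of the computational basis. -/
def oraclePerm {Q Γ : Type*} (W : Type*) [AddCommGroup Γ] (x : Q → Γ) :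
    Equiv.Perm (BasisState Q Γ W) where
  toFun s := (s.1, s.2.1 + x s.1, s.2.2)
  invFun s := (s.1, s.2.1 - x s.1, s.2.2)
  left_inv s := by simp
  right_inv s := by simp

/-- One query to the input `x`: the unitary `|q, b, w⟩ ↦ |q, b + x q, w⟩`. -/
noncomputable def oracle {Q Γ : Type*} (W : Type*) [Fintype Q] [Fintype Γ] [Fintype W]
    [AddCommGroup Γ] (x : Q → Γ) : StateSpace Q Γ W ≃ₗᵢ[ℂ] StateSpace Q Γ W :=
  LinearIsometryEquiv.piLpCongrLeft 2 ℂ ℂ (oraclePerm W x)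

open Classical in
/-- The oracle acts on the computational basis as intended. -/
theorem oracle_single {Q Γ : Type*} (W : Type*) [Fintype Q] [Fintype Γ] [Fintype W]
    [AddCommGroup Γ] (x : Q → Γ) (q : Q) (b : Γ) (w : W) :
    oracle W x (EuclideanSpace.single (q, b, w) (1 : ℂ))
      = EuclideanSpace.single (q, b + x q, w) (1 : ℂ) :=
  LinearIsometryEquiv.piLpCongrLeft_single (oraclePerm W x) (q, b, w) (1 : ℂ)

/-- A quantum query algorithm for inputs `x : Q → Γ` with outputs in `Out`: a finite workspace,
a number of queries `T`, a starting basis state, input-independent unitaries `U 0, …, U T`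
(the later ones are never used), and a classical post-processing of the outcome of a final
measurement in the computational basis. -/
structure Algorithm (Q : Type) (Γ : Type u) (Out : Type) [Fintype Q] [Fintype Γ] where
  /-- the index set of the workspace register -/
  Work : Type u
  /-- the workspace is finite -/
  [fintypeWork : Fintype Work]
  /-- the number of queries -/
  queries : ℕ
  /-- the starting basis state -/
  start : BasisState Q Γ Work
  /-- the unitaries that do not depend on the input -/
  U : ℕ → (StateSpace Q Γ Work ≃ₗᵢ[ℂ] StateSpace Q Γ Work)
  /-- the output produced from the measured basis state -/
  out : BasisState Q Γ Work → Out

attribute [instance] Algorithm.fintypeWork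

namespace Algorithm

variable {Q : Type} {Γ : Type u} {Out : Type} [Fintype Q] [Fintype Γ] [AddCommGroup Γ]

open Classical in
/-- The state `U t · O_x · U (t-1) · O_x ⋯ O_x · U 0 |start⟩`, reached after `t` queries. -/
noncomputable def stateAfter (alg : Algorithm Q Γ Out) (x : Q → Γ) :
    ℕ → StateSpace Q Γ alg.Work
  | 0 => alg.U 0 (EuclideanSpace.single alg.start 1)
  | t + 1 => alg.U (t + 1) (oracle alg.Work x (stateAfter alg x t))

open Classical in
/-- The probability that, on input `x`, the measurement of the final state yields a basis state
whose output satisfies `good`. -/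
noncomputable def successProb (alg : Algorithm Q Γ Out) (x : Q → Γ) (good : Out → Prop) : ℝ :=
  ∑ s with good (alg.out s), ‖alg.stateAfter x alg.queries s‖ ^ 2

end Algorithm

end QuantumQuery

namespace MatrixProductVerification

/-- The entry positions of three `n × n` matrices; the first component selects the matrix. -/
abbrev Position (n : ℕ) : Type := Fin 3 × Fin n × Fin n

/-- The oracle input made of the matrices `A`, `B` and `C`. -/
def input {n : ℕ} {Γ : Type*} (A B C : Matrix (Fin n) (Fin n) Γ) : Position n → Γ :=
  fun p => ![A, B, C] p.1 p.2.1 p.2.2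

/-- Correct answers on matrices `A`, `B`, `C`: `none` (accept) is correct iff `A * B = C`, and
`some (i, j)` is correct iff `(A * B) i j ≠ C i j`. -/
def IsCorrect {n : ℕ} {R : Type*} [Semiring R] (A B C : Matrix (Fin n) (Fin n) R) :
    Option (Fin n × Fin n) → Prop
  | none => A * B = C
  | some (i, j) => (A * B) i j ≠ C i j

end MatrixProductVerification

/-! The proof works with dual adversary certificates (`Convertible`) instead of algorithms.
Certificates can be added, reweighted and controlled, so subroutines compose exactly: their costs
add, with no error reduction and no logarithmic factor. Error enters once, in
`Convertible.exists_algorithm`. There a small catalyst state is borrowed. Each query labels one more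
of `K` branches and restores the catalyst exactly, and replacing the catalyst by zero costs error `4
* W / K`.

The certificate for a wrong entry is a learning graph (`Convertible.decide_exists_pair`): load `r`
rows of `A`, then one more row, then a column of `B` together with the entries of `C` where it meets
the loaded rows. One column serves all `r + 1` rows at once. For `m` candidate rows and all `n`
columns, `r` of order `m ^ (2/3)` gives cost `O(n ^ (3/2) * m ^ (1/6))`, which is `O(n ^ (5/3))` at
`m = n`.

Since this cost is a positive power of `m`, bisection (`Convertible.find`) locates a wrong row at
the price of a geometric series. A second bisection, over columns, costs only `O(n ^ (3/2))`. -/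

namespace QuantumQuery

/-! ### Calculus of adversary certificates and stages of learning graphs. -/

section Conversion

open scoped Classical in
/-- The indicator of `f x ≠ f y`. -/
noncomputable def neqKernel {X β : Type*} (f : X → β) (x y : X) : ℝ := if f x = f y then 0 else 1

theorem neqKernel_congr {X β γ : Type*} {f : X → β} {g : X → γ}
    (h : ∀ x y, f x = f y ↔ g x = g y) : neqKernel f = neqKernel g := by
  classical
  funext x y
  exact if_congr (h x y) rfl rfl

variable {Q Γ : Type*} [Fintype Q]

open scoped Classical in
/-- `Convertible W D`: the kernel `D` on inputs is a signed sum, over the query positions `q`, of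
positive semidefinite kernels restricted to the pairs of inputs that differ at `q`, whose total
diagonal is at most `W`. When `D` is the difference of two Gram matrices, such a decomposition
gives a query algorithm that converts the first family of states into the second. -/
def Convertible (W : (Q → Γ) → ℝ) (D : (Q → Γ) → (Q → Γ) → ℝ) : Prop :=
  ∃ P N : Q → Matrix (Q → Γ) (Q → Γ) ℝ,
    (∀ q, (P q).PosSemidef) ∧ (∀ q, (N q).PosSemidef) ∧
    (∀ x y, D x y = ∑ q, if x q = y q then 0 else P q x y - N q x y) ∧
    ∀ x, ∑ q, (P q x x + N q x x) ≤ W x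

namespace Convertible

variable {W W' : (Q → Γ) → ℝ} {D D' : (Q → Γ) → (Q → Γ) → ℝ}

theorem mono (h : Convertible W D) (hW : ∀ x, W x ≤ W' x) : Convertible W' D := by
  obtain ⟨P, N, hP, hN, hD, hc⟩ := h
  exact ⟨P, N, hP, hN, hD, fun x => (hc x).trans (hW x)⟩

protected theorem zero : Convertible (fun _ : Q → Γ => 0) (fun _ _ => 0) :=
  ⟨0, 0, fun _ => .zero, fun _ => .zero, by simp, by simp⟩

protected theorem add (h : Convertible W D) (h' : Convertible W' D') :
    Convertible (fun x => W x + W' x) (fun x y => D x y + D' x y) := by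
  obtain ⟨P, N, hP, hN, hD, hc⟩ := h
  obtain ⟨P', N', hP', hN', hD', hc'⟩ := h'
  refine ⟨P + P', N + N', fun q => (hP q).add (hP' q), fun q => (hN q).add (hN' q), ?_, ?_⟩
  · intro x y
    beta_reduce
    rw [hD, hD', ← Finset.sum_add_distrib]
    refine Finset.sum_congr rfl fun q _ => ?_
    split_ifs
    · simp
    · simp only [Pi.add_apply, Matrix.add_apply]; ring
  · intro x
    refine le_trans (le_of_eq ?_) (add_le_add (hc x) (hc' x))
    rw [← Finset.sum_add_distrib]
    refine Finset.sum_congr rfl fun q _ => ?_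
    simp only [Pi.add_apply, Matrix.add_apply]; ring

protected theorem sum {ι : Type*} (s : Finset ι) {W : ι → (Q → Γ) → ℝ}
    {D : ι → (Q → Γ) → (Q → Γ) → ℝ} (h : ∀ i ∈ s, Convertible (W i) (D i)) :
    Convertible (fun x => ∑ i ∈ s, W i x) (fun x y => ∑ i ∈ s, D i x y) := by
  classical
  induction s using Finset.induction_on with
  | empty => simpa using Convertible.zero
  | insert i s hi ih =>
    simp only [Finset.sum_insert hi]
    exact (h i (by simp)).add (ih fun j hj => h j (by simp [hj]))

protected theorem neg (h : Convertible W D) : Convertible W (fun x y => -D x y) := by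
  obtain ⟨P, N, hP, hN, hD, hc⟩ := h
  refine ⟨N, P, hN, hP, fun x y => ?_, fun x => by simpa only [add_comm] using hc x⟩
  beta_reduce
  rw [hD, ← Finset.sum_neg_distrib]
  refine Finset.sum_congr rfl fun q _ => ?_
  split_ifs <;> simp

/-- Conjugating each positive semidefinite matrix by the diagonal matrix of `a` preserves positivity
and multiplies the diagonal by `a x ^ 2`. -/
theorem rescale [Fintype Γ] (h : Convertible W D) (a : (Q → Γ) → ℝ) :
    Convertible (fun x => a x ^ 2 * W x) (fun x y => a x * a y * D x y) := by
  classical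
  obtain ⟨P, N, hP, hN, hD, hc⟩ := h
  have key : ∀ M : Matrix (Q → Γ) (Q → Γ) ℝ, M.PosSemidef →
      (Matrix.of fun x y => a x * a y * M x y).PosSemidef := by
    intro M hM
    convert hM.mul_mul_conjTranspose_same (Matrix.diagonal a) using 1
    ext x y
    simp
    ring
  refine ⟨fun q => .of fun x y => a x * a y * P q x y, fun q => .of fun x y => a x * a y * N q x y,
    fun q => key _ (hP q), fun q => key _ (hN q), fun x y => ?_, fun x => ?_⟩
  · beta_reduce
    rw [hD, Finset.mul_sum]
    refine Finset.sum_congr rfl fun q _ => ?_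
    split_ifs
    · simp
    · simp only [Matrix.of_apply]; ring
  · refine le_trans (le_of_eq ?_) (mul_le_mul_of_nonneg_left (hc x) (sq_nonneg (a x)))
    rw [Finset.mul_sum]
    refine Finset.sum_congr rfl fun q _ => ?_
    simp only [Matrix.of_apply]; ring

-- Each certificate is cut down by the 0/1 indicator of `g x = b` and the results are summed. An
-- input survives in a single summand, so it pays only for its own branch.
open scoped Classical in
theorem control [Fintype Γ] {β : Type*} (g : (Q → Γ) → β) {W : β → (Q → Γ) → ℝ}
    {D : β → (Q → Γ) → (Q → Γ) → ℝ} (h : ∀ b, Convertible (W b) (D b)) :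
    Convertible (fun x => W (g x) x) (fun x y => if g x = g y then D (g x) x y else 0) := by
  have := Convertible.sum (Finset.univ.image g)
    (fun b _ => (h b).rescale fun x => if g x = b then 1 else 0)
  have e : ∀ x, g x ∈ Finset.univ.image g := fun x => by simp
  convert this using 1
  · funext x
    rw [Finset.sum_eq_single_of_mem (g x) (e x)]
    · simp
    · intro b _ hb; simp [hb.symm]
  · funext x y
    rw [Finset.sum_eq_single_of_mem (g x) (e x)]
    · by_cases hxy : g x = g y
      · simp [hxy]
      · simp [hxy, Ne.symm hxy]
    · intro b _ hb; simp [hb.symm]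

theorem query [Finite Γ] (q : Q) :
    Convertible (fun _ : Q → Γ => 1) (neqKernel fun x : Q → Γ => x q) := by
  classical
  have h1 : (Matrix.of fun _ _ => 1 : Matrix (Q → Γ) (Q → Γ) ℝ).PosSemidef := by
    convert Matrix.posSemidef_vecMulVec_self_star (R := ℝ) (fun _ : Q → Γ => (1 : ℝ)) using 1
    ext x y
    simp [Matrix.vecMulVec_apply]
  refine ⟨fun p => if p = q then .of fun _ _ => 1 else 0, 0, ?_, fun _ => .zero, ?_, ?_⟩
  · intro p
    dsimp only
    split_ifs
    · exact h1
    · exact .zero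
  · intro x y
    rw [Finset.sum_eq_single q (by intro p _ hp; simp [hp]) (by simp)]
    simp [neqKernel]
  · intro x
    rw [Finset.sum_eq_single q (by intro p _ hp; simp [hp]) (by simp)]
    simp

/-- First compute the label `f x`, then a function of the input that depends on this label. -/
theorem pair [Fintype Γ] {β γ : Type*} {f : (Q → Γ) → β} {g : β → (Q → Γ) → γ}
    {V : β → (Q → Γ) → ℝ} (hf : Convertible W (neqKernel f))
    (hg : ∀ b, Convertible (V b) (neqKernel (g b))) :
    Convertible (fun x => W x + V (f x) x) (neqKernel fun x => (f x, g (f x) x)) := by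
  classical
  -- Pairs of labels differ either in the first component, or, when that agrees, in the second;
  -- these cases are disjoint, so the kernels add.
  convert hf.add (control f hg) using 1
  funext x y
  by_cases h : f x = f y
  · simp [neqKernel, h]
  · simp [neqKernel, h]

/-- The restriction of `x` to `S` can be loaded with `S.card` queries. -/
theorem load [Fintype Γ] (S : Finset Q) :
    Convertible (fun _ : Q → Γ => (S.card : ℝ)) (neqKernel fun (x : Q → Γ) (q : S) => x q) := by
  classical
  induction S using Finset.induction_on with
  | empty =>
    convert Convertible.zero (Q := Q) (Γ := Γ) using 1
    · simp
    · funext x y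
      simp only [neqKernel, ite_eq_left_iff]
      intro h
      exact absurd (funext fun q => absurd q.2 (Finset.notMem_empty _)) h
  | insert q S hq ih =>
    have := ih.pair (fun _ => query (Γ := Γ) q)
    rw [neqKernel_congr (g := fun (x : Q → Γ) (p : (insert q S : Finset Q)) => x p)] at this
    · refine this.mono fun x => ?_
      simp [Finset.card_insert_of_notMem hq]
    · intro x y
      simp only [Prod.mk.injEq, funext_iff, Subtype.forall, Finset.mem_insert]
      grind

open scoped Classical in
/-- Having loaded the positions in `S`, load those in `S'`. -/
theorem loadMore [Fintype Γ] (S S' : Finset Q) :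
    Convertible (fun _ : Q → Γ => (S'.card : ℝ)) (fun x y =>
      neqKernel (fun (x : Q → Γ) (q : (S ∪ S' : Finset Q)) => x q) x y
        - neqKernel (fun (x : Q → Γ) (q : S) => x q) x y) := by
  -- If two inputs already differ on `S`, both kernels are `1` and cancel; otherwise only `S'`
  -- matters.
  convert control (fun (x : Q → Γ) (q : S) => x q) (fun _ => load (Γ := Γ) S') using 1
  funext x y
  simp only [neqKernel, funext_iff, Subtype.forall, Finset.mem_union]
  by_cases h : ∀ a ∈ S, x a = y a
  · by_cases h' : ∀ a ∈ S', x a = y a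
    · have : ∀ a, a ∈ S ∨ a ∈ S' → x a = y a := by grind
      rw [if_pos this, if_pos h, if_pos h, if_pos h']; ring
    · have : ¬ ∀ a, a ∈ S ∨ a ∈ S' → x a = y a := by grind
      rw [if_neg this, if_pos h, if_pos h, if_neg h']; ring
  · have : ¬ ∀ a, a ∈ S ∨ a ∈ S' → x a = y a := by grind
    rw [if_neg this, if_neg h, if_neg h]; ring

/-- A kernel that equals `1` across a property decides the property. -/
theorem decide [Fintype Γ] {p : (Q → Γ) → Prop} (h : Convertible W D)
    (hD : ∀ x y, p x → ¬ p y → D x y = 1 ∧ D y x = 1) :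
    Convertible W (neqKernel p) := by
  classical
  -- Averaging `D` with its sign-twisted negative kills pairs on the same side of `p` and keeps `D`
  -- across it, at unchanged cost.
  have h2 := (h.add (h.rescale fun x => if p x then 1 else -1).neg).rescale fun _ => √2⁻¹
  have hs : √2⁻¹ * √2⁻¹ = (2⁻¹ : ℝ) := Real.mul_self_sqrt (by norm_num)
  have e : neqKernel p = fun x y => √2⁻¹ * √2⁻¹ * (D x y + -((if p x then (1 : ℝ) else -1)
      * (if p y then 1 else -1) * D x y)) := by
    funext x y
    rw [hs]
    by_cases hx : p x <;> by_cases hy : p y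
    · simp [neqKernel, hx, hy]
    · simp [neqKernel, hx, hy, (hD x y hx hy).1]; norm_num
    · simp [neqKernel, hx, hy, (hD y x hy hx).2]; norm_num
    · simp [neqKernel, hx, hy]
  rw [e]
  refine h2.mono fun x => le_of_eq ?_
  rw [sq, hs]
  split_ifs <;> ring

open scoped Classical in
/-- A stage of a learning graph: of the transitions `D e`, `e ∈ E`, a positive input `x` uses those
in `F x`, with uniform flow, and a negative input uses all of them. -/
theorem stage [Fintype Γ] {ι : Type*} (E : Finset ι) (p : (Q → Γ) → Prop)
    (F : (Q → Γ) → Finset ι) {D : ι → (Q → Γ) → (Q → Γ) → ℝ} {c s N : ℝ} (hc : 0 ≤ c)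
    (hs : 0 < s) (hN : 0 < N) (hD : ∀ e ∈ E, Convertible (fun _ => c) (D e))
    (hF : ∀ x, p x → F x ⊆ E) (hFcard : ∀ x, p x → ((F x).card : ℝ) = N)
    (hE : (E.card : ℝ) ≤ N * s ^ 2) :
    ∃ T : (Q → Γ) → (Q → Γ) → ℝ, Convertible (fun _ => c * s) T ∧
      (∀ x y, p x → ¬ p y → T x y = N⁻¹ * ∑ e ∈ F x, D e x y) ∧
      (∀ x y, p x → ¬ p y → T y x = N⁻¹ * ∑ e ∈ F x, D e y x) := by
  have hamp : √(s / N) * (√(N * s))⁻¹ = N⁻¹ := by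
    rw [← Real.sqrt_inv, ← Real.sqrt_mul (by positivity),
      show s / N * (N * s)⁻¹ = N⁻¹ ^ 2 by field_simp, Real.sqrt_sq (by positivity)]
  -- The positive and negative amplitudes multiply to the uniform flow `N⁻¹`; their ratio is chosen
  -- so that either kind of input pays at most `c * s`.
  let a : ι → (Q → Γ) → ℝ := fun e x =>
    if p x then (if e ∈ F x then √(s / N) else 0) else (√(N * s))⁻¹
  refine ⟨fun x y => ∑ e ∈ E, a e x * a e y * D e x y,
    (Convertible.sum E fun e he => (hD e he).rescale (a e)).mono ?_, ?_, ?_⟩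
  · intro x
    by_cases hx : p x
    · have : ∀ e, a e x ^ 2 * c = if e ∈ F x then s / N * c else 0 := by
        intro e
        simp only [a, hx, if_true]
        split_ifs
        · rw [Real.sq_sqrt (by positivity)]
        · simp
      simp only [this]
      rw [← Finset.sum_filter, Finset.filter_mem_eq_inter,
        Finset.inter_eq_right.2 (hF x hx), Finset.sum_const, nsmul_eq_mul, hFcard x hx]
      apply le_of_eq
      field_simp
    · simp only [a, hx, if_false, Finset.sum_const, nsmul_eq_mul, inv_pow]
      rw [Real.sq_sqrt (by positivity)]
      calc (E.card : ℝ) * ((N * s)⁻¹ * c) ≤ N * s ^ 2 * ((N * s)⁻¹ * c) := by gcongr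
        _ = c * s := by field_simp
  · intro x y hx hy
    beta_reduce
    rw [Finset.mul_sum, ← Finset.sum_subset (hF x hx)]
    · refine Finset.sum_congr rfl fun e he => ?_
      simp [a, hx, hy, he, hamp]
    · intro e _ he
      simp [a, hx, he]
  · intro x y hx hy
    beta_reduce
    rw [Finset.mul_sum, ← Finset.sum_subset (hF x hx)]
    · refine Finset.sum_congr rfl fun e he => ?_
      simp only [a, hx, hy, he, if_true, if_false]
      rw [mul_comm _ (√(s / N)), hamp]
    · intro e _ he
      simp [a, hx, he]

end Convertible

end Conversion

end QuantumQuery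

/-! ### From a certificate to a query algorithm, by means of a catalyst. -/

namespace QuantumQuery

/-- Two families of vectors with the same Gram matrix differ by a unitary. -/
theorem exists_unitary_of_inner_eq {E ι : Type*} [NormedAddCommGroup E] [InnerProductSpace ℂ E]
    [FiniteDimensional ℂ E] (a b : ι → E)
    (h : ∀ i j, inner ℂ (a i) (a j) = inner ℂ (b i) (b j)) :
    ∃ U : E ≃ₗᵢ[ℂ] E, ∀ i, U (a i) = b i := by
  let A := Finsupp.linearCombination ℂ a
  let B := Finsupp.linearCombination ℂ b
  have hinner : ∀ c, inner ℂ (A c) (A c) = inner ℂ (B c) (B c) := by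
    intro c
    simp only [A, B, Finsupp.linearCombination_apply, Finsupp.sum, sum_inner, inner_sum,
      inner_smul_left, inner_smul_right, h]
  have hnorm : ∀ c, ‖A c‖ = ‖B c‖ := by
    intro c
    rw [@norm_eq_sqrt_re_inner ℂ, @norm_eq_sqrt_re_inner ℂ, hinner]
  -- Equal norms make `a i ↦ b i` a well-defined isometry on the span, which extends to the whole
  -- space because the dimension is finite.
  have hker : LinearMap.ker A ≤ LinearMap.ker B := by
    intro c hc
    rw [LinearMap.mem_ker, ← norm_eq_zero] at *
    rw [← hnorm, hc]
  let f : LinearMap.range A →ₗ[ℂ] E :=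
    (LinearMap.ker A).liftQ B hker ∘ₗ A.quotKerEquivRange.symm.toLinearMap
  have hf : ∀ c, f ⟨A c, LinearMap.mem_range_self A c⟩ = B c := by
    intro c
    have : A.quotKerEquivRange.symm ⟨A c, LinearMap.mem_range_self A c⟩
        = Submodule.Quotient.mk c := by
      rw [LinearEquiv.symm_apply_eq]
      rfl
    simp [f, this]
  let L : LinearMap.range A →ₗᵢ[ℂ] E := ⟨f, by
    rintro ⟨_, c, rfl⟩
    rw [hf, ← hnorm]
    rfl⟩
  refine ⟨L.extend.toLinearIsometryEquiv rfl, fun i => ?_⟩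
  have hA : A (Finsupp.single i 1) = a i := by simp [A]
  have hB : B (Finsupp.single i 1) = b i := by simp [B]
  have := L.extend_apply ⟨A (Finsupp.single i 1), LinearMap.mem_range_self A _⟩
  rw [LinearIsometry.coe_toLinearIsometryEquiv, ← hA, ← hB, ← hf]
  exact this

section RealVector

variable {ι : Type*}

/-- A vector with real coordinates. -/
noncomputable def realVec (g : ι → ℝ) : EuclideanSpace ℂ ι := WithLp.toLp 2 fun s => (g s : ℂ)

theorem realVec_apply (g : ι → ℝ) (s : ι) : realVec g s = g s := rfl

theorem inner_realVec [Fintype ι] (g h : ι → ℝ) :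
    inner ℂ (realVec g) (realVec h) = ((∑ s, g s * h s : ℝ) : ℂ) := by
  simp [PiLp.inner_apply, realVec_apply, mul_comm]

theorem norm_realVec_sub_sq [Fintype ι] (g h : ι → ℝ) :
    ‖realVec g - realVec h‖ ^ 2 = ∑ s, (g s - h s) ^ 2 := by
  rw [EuclideanSpace.norm_sq_eq]
  refine Finset.sum_congr rfl fun s _ => ?_
  rw [PiLp.sub_apply, realVec_apply, realVec_apply, ← Complex.ofReal_sub, Complex.norm_real,
    Real.norm_eq_abs, sq_abs]

end RealVector

theorem oracle_realVec {Q Γ : Type*} (W : Type*) [Fintype Q] [Fintype Γ] [Fintype W]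
    [AddCommGroup Γ] (x : Q → Γ) (g : BasisState Q Γ W → ℝ) :
    oracle W x (realVec g) = realVec fun s => g (s.1, s.2.1 - x s.1, s.2.2) := by
  ext s
  exact congrFun (LinearIsometryEquiv.piLpCongrLeft_apply (𝕜 := ℂ) (oraclePerm W x) _) s

open scoped MatrixOrder in
theorem exists_gram {X : Type*} [Fintype X] {M : Matrix X X ℝ} (hM : M.PosSemidef) :
    ∃ B : Matrix X X ℝ, ∀ x y, ∑ z, B z x * B z y = M x y := by
  classical
  obtain ⟨B, rfl⟩ := CStarAlgebra.nonneg_iff_eq_star_mul_self.mp hM.nonneg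
  exact ⟨B, fun x y => by simp [Matrix.mul_apply, Matrix.star_apply]⟩

/-- The workspace of the algorithm: `K` labelled branches and a catalyst. -/
abbrev CatalystWork (K : ℕ) (O Z : Type*) : Type _ := (Fin K × O) ⊕ (Bool × Z)

section Catalyst

variable {Q Γ O Z : Type*} {K : ℕ} [Fintype Q] [Fintype Γ]
  [DecidableEq O] [DecidableEq Γ]

/-- A uniform superposition of `K` branches labelled by `lab`, on which queries act trivially,
together with a catalyst that is scaled down by `√K`. -/
noncomputable def catalystVec (lab : Fin K → O) (α₁ α₂ : Q → Γ) (u₁ u₂ : Q → Z → ℝ) :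
    BasisState Q Γ (CatalystWork K O Z) → ℝ
  | (_, _, .inl (k, o)) =>
    if o = lab k then (√(K * (Fintype.card Q * Fintype.card Γ)))⁻¹ else 0
  | (q, b, .inr (true, z)) => if b = α₁ q then (√K)⁻¹ * u₁ q z else 0
  | (q, b, .inr (false, z)) => if b = α₂ q then (√K)⁻¹ * u₂ q z else 0

variable [Fintype O] [Fintype Z] [Nonempty Q] [Nonempty Γ]

theorem sum_catalystVec_mul (lab lab' : Fin K → O) (α₁ α₂ α₁' α₂' : Q → Γ)
    (u₁ u₂ u₁' u₂' : Q → Z → ℝ) :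
    ∑ s, catalystVec lab α₁ α₂ u₁ u₂ s * catalystVec lab' α₁' α₂' u₁' u₂' s
      = (K : ℝ)⁻¹ * (∑ k, (if lab k = lab' k then 1 else 0) +
          ∑ q, ((if α₁ q = α₁' q then ∑ z, u₁ q z * u₁' q z else 0)
            + if α₂ q = α₂' q then ∑ z, u₂ q z * u₂' q z else 0)) := by
  have hK : (√(K : ℝ))⁻¹ * (√(K : ℝ))⁻¹ = (K : ℝ)⁻¹ := by
    rw [← mul_inv, Real.mul_self_sqrt (by positivity)]
  have hQ : (Fintype.card Q : ℝ) ≠ 0 := by simp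
  have hΓ : (Fintype.card Γ : ℝ) ≠ 0 := by simp
  have hidle : ∀ k : Fin K, ∑ o, (if o = lab k then
        (√(K * (Fintype.card Q * Fintype.card Γ) : ℝ))⁻¹ else 0) *
      (if o = lab' k then (√(K * (Fintype.card Q * Fintype.card Γ) : ℝ))⁻¹ else 0)
      = (K * (Fintype.card Q * Fintype.card Γ) : ℝ)⁻¹ * (if lab k = lab' k then 1 else 0) := by
    intro k
    rw [Finset.sum_eq_single (lab k) (by intro o _ ho; simp [ho]) (by simp)]
    rw [if_pos rfl]
    split_ifs
    · rw [← mul_inv, Real.mul_self_sqrt (by positivity), mul_one]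
    · simp
  have hcat : ∀ (α α' : Q → Γ) (u u' : Q → Z → ℝ) (q : Q), ∑ b, ∑ z,
      (if b = α q then (√(K : ℝ))⁻¹ * u q z else 0) *
        (if b = α' q then (√(K : ℝ))⁻¹ * u' q z else 0)
      = (K : ℝ)⁻¹ * if α q = α' q then ∑ z, u q z * u' q z else 0 := by
    intro α α' u u' q
    rw [Finset.sum_eq_single (α q) (by intro b _ hb; simp [hb]) (by simp)]
    simp only [if_true]
    split_ifs
    · rw [Finset.mul_sum, ← hK]
      refine Finset.sum_congr rfl fun z _ => ?_
      ring
    · simp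
  simp only [Fintype.sum_prod_type, Fintype.sum_sum_type, Fintype.sum_bool, catalystVec, hidle,
    Finset.sum_add_distrib, hcat, Finset.sum_const, Finset.card_univ, nsmul_eq_mul, mul_add,
    Finset.mul_sum]
  congr 1
  refine Finset.sum_congr rfl fun k _ => ?_
  field_simp

/-- The price of dropping the catalyst; it is paid once at the start and once at the final
measurement. -/
theorem sum_catalystVec_sub_sq (lab : Fin K → O) (α₁ α₂ α₁' α₂' : Q → Γ) (u₁ u₂ : Q → Z → ℝ) :
    ∑ s, (catalystVec lab α₁ α₂ u₁ u₂ s - catalystVec lab α₁' α₂' 0 0 s) ^ 2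
      = (K : ℝ)⁻¹ * ∑ q, (∑ z, u₁ q z * u₁ q z + ∑ z, u₂ q z * u₂ q z) := by
  have : ∀ a b : ℝ, (a - b) ^ 2 = a * a - 2 * (a * b) + b * b := fun a b => by ring
  simp only [this, Finset.sum_add_distrib, Finset.sum_sub_distrib, ← Finset.mul_sum,
    sum_catalystVec_mul]
  simp
  ring

end Catalyst

theorem norm_stateAfter {Q : Type} {Γ : Type u} {Out : Type} [Fintype Q] [Fintype Γ]
    [AddCommGroup Γ] (alg : Algorithm Q Γ Out) (x : Q → Γ) (t : ℕ) :
    ‖alg.stateAfter x t‖ = 1 := by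
  induction t with
  | zero => simp [Algorithm.stateAfter]
  | succ t ih => simp [Algorithm.stateAfter, ih]

open scoped Classical in
theorem successProb_eq {Q : Type} {Γ : Type u} {Out : Type} [Fintype Q] [Fintype Γ]
    [AddCommGroup Γ] (alg : Algorithm Q Γ Out) (x : Q → Γ) (good : Out → Prop) :
    alg.successProb x good
      = 1 - ∑ s with ¬ good (alg.out s), ‖alg.stateAfter x alg.queries s‖ ^ 2 := by
  rw [eq_sub_iff_add_eq, Algorithm.successProb, Finset.sum_filter_add_sum_filter_not,
    ← EuclideanSpace.norm_sq_eq, norm_stateAfter, one_pow]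

/-- A convertibility certificate of cost `W` for the label `f` gives, for every `K > 0`, a query
algorithm with `K` queries that computes the label up to an error probability of `4 * W / K`. -/
theorem Convertible.exists_algorithm {Q : Type} {Γ : Type u} {O Out : Type} [Fintype Q]
    [Nonempty Q] [Fintype Γ] [AddCommGroup Γ] [Fintype O] {W : ℝ} {f : (Q → Γ) → O}
    (h : Convertible (fun _ => W) (neqKernel f)) (post : O → Out) {K : ℕ} (hK : 0 < K) :
    ∃ alg : Algorithm Q Γ Out, alg.queries = K ∧
      ∀ (x : Q → Γ) (good : Out → Prop), good (post (f x)) →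
        1 - 4 * W / K ≤ alg.successProb x good := by
  classical
  obtain ⟨P, N, hP, hN, hD, hc⟩ := h
  have gram : ∀ M : Q → Matrix (Q → Γ) (Q → Γ) ℝ, (∀ q, (M q).PosSemidef) →
      ∃ u : (Q → Γ) → Q → (Q → Γ) → ℝ, ∀ x y q, ∑ z, u x q z * u y q z = M q x y := by
    intro M hM
    choose B hB using fun q => exists_gram (hM q)
    exact ⟨fun x q z => B q z x, fun x y q => hB q x y⟩
  obtain ⟨u, hu⟩ := gram P hP
  obtain ⟨v, hv⟩ := gram N hN
  let lab : ℕ → (Q → Γ) → Fin K → Option O := fun t x k => if k.1 < t then some (f x) else none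
  -- The ideal state after `t` queries: `t` branches carry the label. A query moves the answer
  -- register of the `P` part from `0` to `x` and that of the `N` part from `-x` to `0`.
  let ψ : ℕ → (Q → Γ) → BasisState Q Γ (CatalystWork K (Option O) (Q → Γ)) → ℝ :=
    fun t x => catalystVec (lab t x) 0 (-x) (u x) (v x)
  let φ₀ : BasisState Q Γ (CatalystWork K (Option O) (Q → Γ)) → ℝ :=
    catalystVec (fun _ => none) 0 0 0 0
  have hψ₀ : ∀ x, ‖realVec φ₀ - realVec (ψ 0 x)‖ ^ 2 ≤ W / K := by
    intro x
    have hl : lab 0 x = fun _ => none := by funext k; simp [lab]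
    rw [norm_sub_rev, norm_realVec_sub_sq]
    simp only [ψ, φ₀, hl, sum_catalystVec_sub_sq, hu, hv]
    rw [div_eq_inv_mul]
    have := hc x
    gcongr
  have hor : ∀ t x, oracle _ x (realVec (ψ t x))
      = realVec (catalystVec (lab t x) x 0 (u x) (v x)) := by
    intro t x
    rw [oracle_realVec]
    congr 1
    funext ⟨q, b, w⟩
    rcases w with ⟨k, o⟩ | ⟨_ | _, z⟩
    · rfl
    · simp [ψ, catalystVec, sub_eq_iff_eq_add]
    · simp [ψ, catalystVec, sub_eq_iff_eq_add]
  let start : BasisState Q Γ (CatalystWork K (Option O) (Q → Γ)) :=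
    (Classical.arbitrary Q, 0, .inl (⟨0, hK⟩, none))
  obtain ⟨U₀, hU₀⟩ := exists_unitary_of_inner_eq
    (fun _ : Unit =>
      (EuclideanSpace.single start 1 : StateSpace Q Γ (CatalystWork K (Option O) (Q → Γ))))
    (fun _ => realVec φ₀) (by
      intro _ _
      rw [inner_realVec]
      simp only [φ₀, sum_catalystVec_mul]
      have : (K : ℝ) ≠ 0 := by positivity
      simp [this])
  have hstep : ∀ t, ∃ U : StateSpace Q Γ (CatalystWork K (Option O) (Q → Γ)) ≃ₗᵢ[ℂ]
      StateSpace Q Γ (CatalystWork K (Option O) (Q → Γ)), t < K →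
      ∀ x, U (oracle _ x (realVec (ψ t x))) = realVec (ψ (t + 1) x) := by
    intro t
    by_cases ht : t < K
    · obtain ⟨U, hU⟩ := exists_unitary_of_inner_eq
        (fun x => oracle _ x (realVec (ψ t x))) (fun x => realVec (ψ (t + 1) x)) (by
          intro x y
          simp only [hor, inner_realVec]
          simp only [ψ, sum_catalystVec_mul, hu, hv]
          congr 2
          -- Labelling branch `t` lowers the Gram matrix by `neqKernel f`, up to the common factor
          -- `1 / K`. Resetting the catalyst raises it by the same amount, by the certificate
          -- identity.
          have h1 : ∑ k, (if lab t x k = lab t y k then (1 : ℝ) else 0)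
              - ∑ k, (if lab (t + 1) x k = lab (t + 1) y k then (1 : ℝ) else 0)
              = neqKernel f x y := by
            rw [← Finset.sum_sub_distrib, Finset.sum_eq_single ⟨t, ht⟩]
            · by_cases hxy : f x = f y <;> simp [lab, neqKernel, hxy]
            · intro k _ hk
              have : k.1 ≠ t := fun e => hk (Fin.ext e)
              have : k.1 < t + 1 ↔ k.1 < t := by omega
              simp [lab, this]
            · simp
          have h2 : neqKernel f x y
              = ∑ q, ((P q x y + if (-x) q = (-y) q then N q x y else 0)
                - ((if x q = y q then P q x y else 0) + N q x y)) := by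
            rw [hD]
            refine Finset.sum_congr rfl fun q _ => ?_
            by_cases hxy : x q = y q
            · simp [hxy]
            · simp [hxy]
          rw [Finset.sum_sub_distrib] at h2
          simp only [if_true]
          linarith)
      exact ⟨U, fun _ => hU⟩
    · exact ⟨.refl ℂ _, fun h => absurd h ht⟩
  choose U hU using hstep
  let alg : Algorithm Q Γ Out :=
    { Work := CatalystWork K (Option O) (Q → Γ)
      queries := K
      start := start
      U := fun t => Nat.casesOn t U₀ U
      out := fun s => match s.2.2 with
        | .inl (_, some o) => post o
        -- An arbitrary value: the analysis allows every outcome in the catalyst to be wrong.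
        | _ => post (f 0) }
  have hclose : ∀ x t, t ≤ K → ‖alg.stateAfter x t - realVec (ψ t x)‖ ^ 2 ≤ W / K := by
    intro x t
    induction t with
    | zero =>
      intro _
      have : alg.stateAfter x 0 = realVec φ₀ := by
        rw [← hU₀ ()]
        simp only [Algorithm.stateAfter]
        congr!
      rw [this]
      exact hψ₀ x
    | succ t ih =>
      intro ht
      have : alg.stateAfter x (t + 1) = U t (oracle _ x (alg.stateAfter x t)) := rfl
      rw [this, ← hU t ht x, ← map_sub, ← map_sub, LinearIsometryEquiv.norm_map,
        LinearIsometryEquiv.norm_map]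
      exact ih (by omega)
  refine ⟨alg, rfl, fun x good hgood => ?_⟩
  rw [successProb_eq]
  -- After `K` steps every branch carries the correct label, so wrong outcomes have ideal amplitude
  -- only in the catalyst.
  have hbad : ∀ s, ¬ good (alg.out s) →
      ψ K x s = ψ K x s - catalystVec (lab K x) 0 0 0 0 s := by
    rintro ⟨q, b, w⟩ hs
    suffices h0 : catalystVec (lab K x) 0 0 0 0 (q, b, w) = 0 by rw [h0, sub_zero]
    rcases w with ⟨k, o⟩ | ⟨_ | _, z⟩
    · have ho : o ≠ some (f x) := by
        rintro rfl
        exact hs hgood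
      simp [catalystVec, lab, ho]
    · simp [catalystVec]
    · simp [catalystVec]
  have h1 : ∑ s with ¬ good (alg.out s), ‖alg.stateAfter x K s - realVec (ψ K x) s‖ ^ 2
      ≤ W / K := by
    refine le_trans ?_ (hclose x K le_rfl)
    rw [EuclideanSpace.norm_sq_eq]
    exact Finset.sum_le_sum_of_subset_of_nonneg (Finset.filter_subset _ _)
      fun _ _ _ => by positivity
  have h2 : ∑ s with ¬ good (alg.out s), ‖realVec (ψ K x) s‖ ^ 2 ≤ W / K := by
    calc _ = ∑ s with ¬ good (alg.out s),
          (ψ K x s - catalystVec (lab K x) 0 0 0 0 s) ^ 2 := by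
          refine Finset.sum_congr rfl fun s hs => ?_
          rw [← hbad s (Finset.mem_filter.1 hs).2, realVec_apply, Complex.norm_real,
            Real.norm_eq_abs, sq_abs]
      _ ≤ ∑ s, (ψ K x s - catalystVec (lab K x) 0 0 0 0 s) ^ 2 :=
          Finset.sum_le_sum_of_subset_of_nonneg (Finset.filter_subset _ _)
            fun _ _ _ => by positivity
      _ ≤ W / K := by
          simp only [ψ, sum_catalystVec_sub_sq, hu, hv]
          rw [div_eq_inv_mul]
          have := hc x
          gcongr
  have h3 : ∑ s with ¬ good (alg.out s), ‖alg.stateAfter x K s‖ ^ 2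
      ≤ ∑ s with ¬ good (alg.out s), (2 * ‖alg.stateAfter x K s - realVec (ψ K x) s‖ ^ 2
        + 2 * ‖realVec (ψ K x) s‖ ^ 2) := by
    refine Finset.sum_le_sum fun s _ => ?_
    have := norm_le_norm_sub_add (alg.stateAfter x K s) (realVec (ψ K x) s)
    nlinarith [norm_nonneg (alg.stateAfter x K s), sq_nonneg
      (‖alg.stateAfter x K s - realVec (ψ K x) s‖ - ‖realVec (ψ K x) s‖)]
  rw [Finset.sum_add_distrib, ← Finset.mul_sum, ← Finset.mul_sum] at h3
  have h4 : 4 * W / K = 2 * (W / K) + 2 * (W / K) := by ring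
  have h5 : alg.queries = K := rfl
  rw [h5]
  linarith

end QuantumQuery

/-! ### Search by bisection, and the learning graph for pairs. -/

namespace QuantumQuery

namespace Convertible

variable {Q Γ : Type*} [Fintype Q] [Fintype Γ]

/-- If the existence of a witness in `I` can be decided with cost `c * I.card ^ α` for all `I`,
then a witness can be found by bisection with cost `O(I.card ^ α)`. -/
theorem find {ι : Type*} (p : ι → (Q → Γ) → Prop) {c α : ℝ} (hc : 0 ≤ c) (hα : 0 < α)
    (hdec : ∀ I : Finset ι,
      Convertible (fun _ => c * (I.card : ℝ) ^ α) (neqKernel fun x => ∃ i ∈ I, p i x))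
    (I : Finset ι) (hI : I.Nonempty) :
    ∃ h : (Q → Γ) → ι, (∀ x, h x ∈ I) ∧ (∀ x, (∃ i ∈ I, p i x) → p (h x) x) ∧
      Convertible (fun _ => (2 / 3 : ℝ) ^ α / (1 - (2 / 3 : ℝ) ^ α) * c * (I.card : ℝ) ^ α)
        (neqKernel h) := by
  classical
  have hq0 : 0 < (2 / 3 : ℝ) ^ α := by positivity
  have hq1 : (2 / 3 : ℝ) ^ α < 1 := Real.rpow_lt_one (by norm_num) (by norm_num) hα
  set q := (2 / 3 : ℝ) ^ α with hq
  have h1q : 0 < 1 - q := by linarith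
  have hC0 : 0 ≤ q / (1 - q) * c := by positivity
  set C := q / (1 - q) * c with hC
  -- `C` is the fixed point of the recursion: decide on one half, then search in one half.
  have hCq : q * (c + C) = C := by rw [hC]; field_simp; ring
  induction I using Finset.strongInduction with
  | H I ih =>
  by_cases hcard : I.card ≤ 1
  · obtain ⟨i, rfl⟩ := Finset.card_eq_one.1 (le_antisymm hcard hI.card_pos)
    refine ⟨fun _ => i, by simp, by simp, ?_⟩
    have : neqKernel (fun _ : Q → Γ => i) = fun _ _ => 0 := by
      funext x y
      simp [neqKernel]
    rw [this]
    exact Convertible.zero.mono fun x => by positivity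
  · obtain ⟨I₁, hI₁, hcard₁⟩ := Finset.exists_subset_card_eq (Nat.div_le_self I.card 2)
    have hcard₂ : (I \ I₁).card = I.card - I.card / 2 := by
      rw [Finset.card_sdiff_of_subset hI₁, hcard₁]
    have hne₁ : I₁.Nonempty := Finset.card_pos.1 (by omega)
    have hne₂ : (I \ I₁).Nonempty := Finset.card_pos.1 (by omega)
    have hlt₁ : I₁ ⊂ I := Finset.ssubset_of_subset_of_ssubset subset_rfl
      (Finset.ssubset_iff_subset_ne.2 ⟨hI₁, fun e => by rw [e] at hcard₁; omega⟩)
    have hlt₂ : I \ I₁ ⊂ I := Finset.sdiff_ssubset hI₁ hne₁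
    obtain ⟨h₁, hm₁, hp₁, hv₁⟩ := ih I₁ hlt₁ hne₁
    obtain ⟨h₂, hm₂, hp₂, hv₂⟩ := ih (I \ I₁) hlt₂ hne₂
    -- The ratio is `2 / 3` rather than `1 / 2` because the larger half of an odd set is rounded up;
    -- three elements attain it.
    have hpow : ∀ k : ℕ, 3 * k ≤ 2 * I.card → (k : ℝ) ^ α ≤ q * (I.card : ℝ) ^ α := by
      intro k hk
      rw [hq, ← Real.mul_rpow (by norm_num) (by positivity)]
      have : (3 * k : ℝ) ≤ 2 * I.card := by exact_mod_cast hk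
      exact Real.rpow_le_rpow (by positivity) (by linarith) hα.le
    have hb₁ := hpow I₁.card (by omega)
    have hb₂ := hpow (I \ I₁).card (by omega)
    let g : Prop → (Q → Γ) → ι := fun b => if b then h₁ else h₂
    have hg : ∀ b, Convertible (fun _ => C * (q * (I.card : ℝ) ^ α)) (neqKernel (g b)) := by
      intro b
      by_cases hb : b
      · simp only [g, hb, if_true]
        exact hv₁.mono fun _ => by gcongr
      · simp only [g, hb, if_false]
        exact hv₂.mono fun _ => by gcongr
    refine ⟨fun x => g (∃ i ∈ I₁, p i x) x, fun x => ?_, fun x hx => ?_, ?_⟩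
    · by_cases hx : ∃ i ∈ I₁, p i x
      · simp only [g, hx, if_true]
        exact hI₁ (hm₁ x)
      · simp only [g, hx, if_false]
        exact (Finset.mem_sdiff.1 (hm₂ x)).1
    · by_cases hx₁ : ∃ i ∈ I₁, p i x
      · simp only [g, hx₁, if_true]
        exact hp₁ x hx₁
      · simp only [g, hx₁, if_false]
        obtain ⟨i, hi, hpi⟩ := hx
        exact hp₂ x ⟨i, Finset.mem_sdiff.2 ⟨hi, fun h => hx₁ ⟨i, h, hpi⟩⟩, hpi⟩
    · have := (hdec I₁).pair hg
      -- The two halves are disjoint and the index found always lies in the half searched, so it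
      -- determines the outcome of the decision.
      rw [neqKernel_congr (g := fun x => g (∃ i ∈ I₁, p i x) x)] at this
      · refine this.mono fun x => ?_
        calc c * (I₁.card : ℝ) ^ α + C * (q * (I.card : ℝ) ^ α)
            ≤ c * (q * (I.card : ℝ) ^ α) + C * (q * (I.card : ℝ) ^ α) := by gcongr
          _ = q * (c + C) * (I.card : ℝ) ^ α := by ring
          _ = C * (I.card : ℝ) ^ α := by rw [hCq]
      · intro x y
        have e₁ := hm₁ x
        have e₂ := hm₁ y
        have e₃ := (Finset.mem_sdiff.1 (hm₂ x)).2
        have e₄ := (Finset.mem_sdiff.1 (hm₂ y)).2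
        by_cases hx : ∃ i ∈ I₁, p i x <;> by_cases hy : ∃ i ∈ I₁, p i y <;>
          simp only [Prod.mk.injEq, g, hx, hy, if_true, if_false, true_and, and_iff_right_iff_imp]
        · exact fun e => absurd (e ▸ e₁) e₄
        · exact fun e => absurd (e ▸ e₂) e₃

open scoped Classical in
/-- Deciding whether some pair in `I × J` has a property `p`, where `p i j` is certified by the
positions in `row i` and, for any set `T` of rows containing `i`, those in `col T j`. The learning
graph loads `r` rows, then one more row, and then a column. -/
theorem decide_exists_pair {ι κ : Type*} (I : Finset ι) (J : Finset κ) (r : ℕ)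
    (hr : 2 * r ≤ I.card) (hI : I.Nonempty) (hJ : J.Nonempty)
    (row : ι → Finset Q) (col : Finset ι → κ → Finset Q) (p : ι → κ → (Q → Γ) → Prop) {c d : ℝ}
    (hrow : ∀ i, ((row i).card : ℝ) ≤ c)
    (hcol : ∀ T j, T.card = r + 1 → ((col T j).card : ℝ) ≤ d)
    (hp : ∀ T i j x y, i ∈ T → (∀ q ∈ row i, x q = y q) → (∀ q ∈ col T j, x q = y q) →
      p i j x → p i j y) :
    Convertible
      (fun _ => r * c * √2 + c * √I.card + d * √(I.card * J.card / (r + 1)))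
      (neqKernel fun x => ∃ i ∈ I, ∃ j ∈ J, p i j x) := by
  let pos : (Q → Γ) → Prop := fun x => ∃ i ∈ I, ∃ j ∈ J, p i j x
  obtain ⟨i₀, hi₀⟩ := hI
  obtain ⟨j₀, hj₀⟩ := hJ
  have hm : 0 < I.card := Finset.card_pos.2 ⟨i₀, hi₀⟩
  have hm' : 0 < J.card := Finset.card_pos.2 ⟨j₀, hj₀⟩
  have hc : 0 ≤ c := le_trans (by positivity) (hrow i₀)
  obtain ⟨T₀, hT₀⟩ : ∃ T ⊆ I, T.card = r + 1 := Finset.exists_subset_card_eq (by omega)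
  have hd : 0 ≤ d := le_trans (by positivity) (hcol T₀ j₀ hT₀.2)
  have hwit : ∀ x, ∃ i j, pos x → i ∈ I ∧ j ∈ J ∧ p i j x := by
    intro x
    by_cases hx : pos x
    · obtain ⟨i, hi, j, hj, h⟩ := hx
      exact ⟨i, j, fun _ => ⟨hi, hj, h⟩⟩
    · exact ⟨i₀, j₀, fun h => absurd h hx⟩
  choose i j hij using hwit
  let G : (Q → Γ) → Finset (Finset ι) := fun x => (I.erase (i x)).powersetCard r
  let N : ℝ := (I.card - 1).choose r
  have hGcard : ∀ x, pos x → ((G x).card : ℝ) = N := by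
    intro x hx
    simp [G, N, Finset.card_erase_of_mem (hij x hx).1]
  have hN : 0 < N := by
    simp only [N, Nat.cast_pos]
    exact Nat.choose_pos (by omega)
  let κK : Finset Q → (Q → Γ) → (Q → Γ) → ℝ := fun S => neqKernel fun x (q : S) => x q
  have hins : ∀ i R, (insert i R : Finset ι).biUnion row = R.biUnion row ∪ row i := by
    intro i R
    rw [Finset.biUnion_insert, Finset.union_comm]
  let mk : ι → Finset ι ↪ Σ _ : ι, Finset ι := fun i =>
    ⟨fun R => ⟨i, R⟩, fun _ _ h => eq_of_heq (Sigma.mk.inj h).2⟩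
  have hmk : ∀ i R, mk i R = ⟨i, R⟩ := fun _ _ => rfl
  have hG : ∀ x R, R ∈ G x → R ⊆ I ∧ i x ∉ R ∧ R.card = r := by
    intro x R hR
    rw [Finset.mem_powersetCard, Finset.subset_erase] at hR
    exact ⟨hR.1.1, hR.1.2, hR.2⟩
  -- The flow uses the `r`-sets that avoid the witness row; as `2 * r ≤ I.card`, they are at least
  -- half of all `r`-sets, whence `√2`.
  obtain ⟨T₁, hT₁, hT₁l, hT₁r⟩ := stage (Γ := Γ) (I.powersetCard r) pos G (c := r * c) (s := √2)
    (N := N) (D := fun R => κK (R.biUnion row)) (by positivity) (by positivity) hN (by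
      intro R hR
      refine (load _).mono fun _ => ?_
      have h1 : ((R.biUnion row).card : ℝ) ≤ ∑ i ∈ R, ((row i).card : ℝ) := by
        exact_mod_cast Finset.card_biUnion_le
      refine h1.trans ((Finset.sum_le_sum fun i _ => hrow i).trans ?_)
      simp [(Finset.mem_powersetCard.1 hR).2])
    (by
      intro x _ R hR
      exact Finset.mem_powersetCard.2 ⟨(hG x R hR).1, (hG x R hR).2.2⟩)
    hGcard (by
      rw [Finset.card_powersetCard, Real.sq_sqrt (by norm_num)]
      have h1 := Nat.choose_mul_succ_eq (I.card - 1) r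
      rw [show I.card - 1 + 1 = I.card by omega] at h1
      have h2 : I.card.choose r * (I.card - r) * 2
          ≤ (I.card - 1).choose r * 2 * (2 * (I.card - r)) := by
        rw [← h1, mul_assoc, mul_assoc]
        exact Nat.mul_le_mul_left _ (by omega)
      have h3 : I.card.choose r ≤ (I.card - 1).choose r * 2 :=
        Nat.le_of_mul_le_mul_right (c := (I.card - r) * 2) (by linarith) (by omega)
      simp only [N]
      exact_mod_cast h3)
  -- Only the witness row is added, one choice out of `I.card`.
  obtain ⟨T₂, hT₂, hT₂l, hT₂r⟩ := stage (Γ := Γ) (I.sigma fun i => (I.erase i).powersetCard r) pos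
    (fun x => (G x).map (mk (i x))) (c := c) (s := √I.card) (N := N)
    (D := fun e x y => κK ((insert e.1 e.2).biUnion row) x y - κK (e.2.biUnion row) x y)
    hc (by positivity) hN (by
      rintro ⟨i, R⟩ _
      simp only [hins]
      exact (loadMore _ _).mono fun _ => hrow i)
    (by
      intro x hx e he
      obtain ⟨R, hR, rfl⟩ := Finset.mem_map.1 he
      exact Finset.mem_sigma.2 ⟨(hij x hx).1, hR⟩)
    (by
      intro x hx
      rw [Finset.card_map, hGcard x hx])
    (by
      rw [Finset.card_sigma, Real.sq_sqrt (by positivity),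
        Finset.sum_congr rfl (g := fun _ => (I.card - 1).choose r) fun i hi => by
          rw [Finset.card_powersetCard, Finset.card_erase_of_mem hi]]
      simp [N, mul_comm])
  have hinj : ∀ x, Set.InjOn (fun R => (insert (i x) R, j x)) (G x : Set (Finset ι)) := by
    intro x R hR R' hR' e
    have e' : insert (i x) R = insert (i x) R' := congrArg Prod.fst e
    rw [← Finset.erase_insert (hG x R hR).2.1, e', Finset.erase_insert (hG x R' hR').2.1]
  -- A transition records the set of rows but not which row came last. This merging is what gains
  -- the divisor `r + 1`.
  obtain ⟨T₃, hT₃, hT₃l, hT₃r⟩ := stage (Γ := Γ) (I.powersetCard (r + 1) ×ˢ J) pos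
    (fun x => (G x).image fun R => (insert (i x) R, j x)) (c := d)
    (s := √(I.card * J.card / (r + 1))) (N := N)
    (D := fun e x y => κK (e.1.biUnion row ∪ col e.1 e.2) x y - κK (e.1.biUnion row) x y)
    hd (by positivity) hN (by
      rintro ⟨T, j⟩ he
      have := (Finset.mem_powersetCard.1 (Finset.mem_product.1 he).1).2
      exact (loadMore _ _).mono fun _ => hcol T j this)
    (by
      intro x hx e he
      obtain ⟨R, hR, rfl⟩ := Finset.mem_image.1 he
      obtain ⟨h1, h2, h3⟩ := hG x R hR
      rw [Finset.mem_product, Finset.mem_powersetCard, Finset.card_insert_of_notMem h2, h3]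
      exact ⟨⟨Finset.insert_subset (hij x hx).1 h1, rfl⟩, (hij x hx).2.1⟩)
    (by
      intro x hx
      rw [Finset.card_image_of_injOn (hinj x), hGcard x hx])
    (by
      rw [Finset.card_product, Finset.card_powersetCard, Real.sq_sqrt (by positivity)]
      have h1 := Nat.add_one_mul_choose_eq (I.card - 1) r
      rw [show I.card - 1 + 1 = I.card by omega] at h1
      have h2 : (I.card : ℝ) * N = I.card.choose (r + 1) * (r + 1) := by
        simp only [N]
        exact_mod_cast h1
      push_cast
      rw [mul_div_assoc', ← mul_assoc, mul_comm N, h2]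
      apply le_of_eq
      field_simp)
  refine (((hT₁.add hT₂).add hT₃).decide (p := pos) ?_).mono fun _ => le_rfl
  -- Along each path of the flow the stages telescope to the kernel of everything loaded. It equals
  -- `1`, because agreement there would carry the witness over to the negative input.
  have htotal : ∀ x y x' y', pos x → ¬ pos y → (x' = x ∧ y' = y ∨ x' = y ∧ y' = x) →
      N⁻¹ * ∑ R ∈ G x, κK (R.biUnion row) x' y'
        + N⁻¹ * ∑ e ∈ (G x).map (mk (i x)),
          (κK ((insert e.1 e.2).biUnion row) x' y' - κK (e.2.biUnion row) x' y')
        + N⁻¹ * ∑ e ∈ (G x).image fun R => (insert (i x) R, j x),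
          (κK (e.1.biUnion row ∪ col e.1 e.2) x' y' - κK (e.1.biUnion row) x' y') = 1 := by
    intro x y x' y' hx hy hxy
    rw [Finset.sum_map, Finset.sum_image (hinj x), ← mul_add, ← mul_add, ← Finset.sum_add_distrib,
      ← Finset.sum_add_distrib, Finset.sum_congr rfl (g := fun _ => (1 : ℝ))]
    · rw [Finset.sum_const, nsmul_eq_mul, hGcard x hx, mul_one, inv_mul_cancel₀ hN.ne']
    · intro R _
      simp only [hmk]
      rw [add_sub_cancel, add_sub_cancel]
      simp only [κK, neqKernel, ite_eq_right_iff]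
      intro e
      simp only [funext_iff, Subtype.forall] at e
      refine absurd ?_ hy
      obtain ⟨h1, h2, h3⟩ := hij x hx
      have hi := Finset.mem_insert_self (i x) R
      have e' : ∀ q ∈ (insert (i x) R).biUnion row ∪ col (insert (i x) R) (j x), x q = y q := by
        rcases hxy with ⟨rfl, rfl⟩ | ⟨rfl, rfl⟩
        · exact e
        · exact fun q hq => (e q hq).symm
      exact ⟨i x, h1, j x, h2, hp _ _ _ x y hi
        (fun q hq => e' q (Finset.mem_union_left _ (Finset.mem_biUnion.2 ⟨_, hi, hq⟩)))
        (fun q hq => e' q (Finset.mem_union_right _ hq)) h3⟩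
  intro x y hx hy
  constructor
  · rw [hT₁l x y hx hy, hT₂l x y hx hy, hT₃l x y hx hy]
    exact htotal x y x y hx hy (.inl ⟨rfl, rfl⟩)
  · rw [hT₁r x y hx hy, hT₂r x y hx hy, hT₃r x y hx hy]
    exact htotal x y y x hx hy (.inr ⟨rfl, rfl⟩)

end Convertible

end QuantumQuery

/-! ### Certificates for wrong entries of a matrix product. -/

namespace MatrixProductVerification

open QuantumQuery

section Label

variable {n : ℕ} {Γ R : Type*} [Semiring R]

/-- The entry `(i, j)` of the product is wrong on the input `x`. -/
def IsWrong (val : Γ → R) (x : Position n → Γ) (i j : Fin n) : Prop :=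
  ∑ k, val (x (0, i, k)) * val (x (1, k, j)) ≠ val (x (2, i, j))

theorem isWrong_input (val : Γ → R) (A B C : Matrix (Fin n) (Fin n) Γ) (i j : Fin n) :
    IsWrong val (input A B C) i j ↔ (A.map val * B.map val) i j ≠ C.map val i j := by
  rw [Matrix.mul_apply]
  exact Iff.rfl

open scoped Classical in
/-- The post-processing of the label computed by the algorithm. -/
noncomputable def answer (l : Prop × Fin n × Fin n) : Option (Fin n × Fin n) :=
  if l.1 then some l.2 else none

theorem isCorrect_answer (val : Γ → R) (A B C : Matrix (Fin n) (Fin n) Γ) (i j : Fin n)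
    (h : (∃ i j, IsWrong val (input A B C) i j) → IsWrong val (input A B C) i j) :
    IsCorrect (A.map val) (B.map val) (C.map val)
      (answer (∃ i j, IsWrong val (input A B C) i j, i, j)) := by
  by_cases hw : ∃ i j, IsWrong val (input A B C) i j
  · simpa only [answer, hw, if_true, IsCorrect] using (isWrong_input val A B C i j).1 (h hw)
  · simp only [answer, hw, if_false, IsCorrect]
    ext i j
    by_contra hij
    exact hw ⟨i, j, (isWrong_input val A B C i j).2 hij⟩

variable [Fintype Γ]

theorem convertible_exists_isWrong (val : Γ → R) (I J : Finset (Fin n)) (r : ℕ)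
    (hr : 2 * r ≤ I.card) (hI : I.Nonempty) (hJ : J.Nonempty) :
    Convertible (Q := Position n) (Γ := Γ)
      (fun _ => r * n * √2 + n * √I.card + 2 * n * √(I.card * J.card / (r + 1)))
      (neqKernel fun x => ∃ i ∈ I, ∃ j ∈ J, IsWrong val x i j) := by
  classical
  refine Convertible.decide_exists_pair I J r hr hI hJ
    (fun i => Finset.univ.image fun k => (0, i, k))
    -- The entries of `C` are loaded for every row in `T`, so that the step does not depend on the
    -- wrong row; this at most doubles the `n` queries for the column.
    (fun T j => (Finset.univ.image fun k => (1, k, j)) ∪ T.image fun i => (2, i, j))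
    (fun i j x => IsWrong val x i j) ?_ ?_ ?_
  · intro i
    exact_mod_cast Finset.card_image_le.trans (by simp)
  · intro T j _
    have h1 : (Finset.univ.image fun k : Fin n => ((1, k, j) : Position n)).card ≤ n :=
      Finset.card_image_le.trans (by simp)
    have h2 : (T.image fun i => ((2, i, j) : Position n)).card ≤ n :=
      Finset.card_image_le.trans (by simpa using Finset.card_le_univ T)
    have h3 := Finset.card_union_le (Finset.univ.image fun k : Fin n => ((1, k, j) : Position n))
      (T.image fun i => ((2, i, j) : Position n))
    exact_mod_cast h3.trans (by omega)
  · intro T i j x y hi hr hc hx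
    have h0 : ∀ k, x (0, i, k) = y (0, i, k) := fun k =>
      hr _ (Finset.mem_image_of_mem _ (Finset.mem_univ k))
    have h1 : ∀ k, x (1, k, j) = y (1, k, j) := fun k =>
      hc _ (Finset.mem_union_left _ (Finset.mem_image.2 ⟨k, Finset.mem_univ k, rfl⟩))
    have h2 : x (2, i, j) = y (2, i, j) :=
      hc _ (Finset.mem_union_right _ (Finset.mem_image.2 ⟨i, hi, rfl⟩))
    simpa only [IsWrong, h0, h1, h2] using hx

/-- With `u = m ^ (1/6)` the choice of `r` near `u ^ 4 / 2` balances the first and third stages when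
`m = m' = n`. For smaller `m` it still suffices, since `u ^ 3 = √m ≤ √n`. -/
theorem learningGraph_cost_le {m m' r n u : ℝ} (hr : 0 ≤ r) (hu : 1 ≤ u) (hm : m = u ^ 6)
    (hmn : m ≤ n) (hm' : m' ≤ n) (hru : 2 * r ≤ u ^ 4) (hur : u ^ 4 ≤ 2 * (r + 1)) :
    r * n * √2 + n * √m + 2 * n * √(m * m' / (r + 1)) ≤ 5 * (n * √n) * u := by
  have hu0 : 0 < u := by linarith
  have hn : 0 ≤ n := le_trans (by rw [hm]; positivity) hmn
  have h2 : √2 ≤ (3 / 2 : ℝ) := Real.sqrt_le_iff.2 ⟨by norm_num, by norm_num⟩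
  have hsm : √m = u ^ 3 := by
    rw [hm, show u ^ 6 = (u ^ 3) ^ 2 by ring, Real.sqrt_sq (by positivity)]
  have hv : u ^ 3 ≤ √n := hsm ▸ Real.sqrt_le_sqrt hmn
  have h1 : r * √2 ≤ 3 / 4 * (u * √n) := by
    calc r * √2 ≤ (u ^ 4 / 2) * (3 / 2) := by gcongr; linarith
      _ = 3 / 4 * (u * u ^ 3) := by ring
      _ ≤ 3 / 4 * (u * √n) := by gcongr
  have h3 : √m ≤ u * √n := by
    rw [hsm]
    exact hv.trans (le_mul_of_one_le_left (Real.sqrt_nonneg _) hu)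
  have h4 : √(m * m' / (r + 1)) ≤ 3 / 2 * (u * √n) := by
    apply Real.sqrt_le_iff.2 ⟨by positivity, ?_⟩
    rw [mul_pow, mul_pow, Real.sq_sqrt hn, div_le_iff₀ (by positivity), hm]
    calc u ^ 6 * m' ≤ u ^ 6 * n := by gcongr
      _ = u ^ 2 * n * u ^ 4 := by ring
      _ ≤ u ^ 2 * n * (2 * (r + 1)) := by gcongr
      _ ≤ (3 / 2) ^ 2 * (u ^ 2 * n) * (r + 1) := by
        have : 0 ≤ u ^ 2 * n * (r + 1) := by positivity
        linarith
  calc _ = n * (r * √2 + √m + 2 * √(m * m' / (r + 1))) := by ring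
    _ ≤ n * (3 / 4 * (u * √n) + u * √n + 2 * (3 / 2 * (u * √n))) := by gcongr
    _ ≤ 5 * (n * √n) * u := by
      have : 0 ≤ n * (u * √n) := by positivity
      linarith

theorem convertible_neqKernel_false {Q Γ : Type*} [Fintype Q] {p : (Q → Γ) → Prop} {W : ℝ}
    (hW : 0 ≤ W) (hp : ∀ x, ¬ p x) : Convertible (fun _ => W) (neqKernel p) := by
  have : neqKernel p = fun _ _ => 0 := by
    funext x y
    simp [neqKernel, hp]
  rw [this]
  exact Convertible.zero.mono fun _ => hW

theorem convertible_wrongRow (val : Γ → R) (I : Finset (Fin n)) :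
    Convertible (Q := Position n) (Γ := Γ) (fun _ => 5 * (n * √n) * (I.card : ℝ) ^ (1 / 6 : ℝ))
      (neqKernel fun x => ∃ i ∈ I, ∃ j, IsWrong val x i j) := by
  rcases I.eq_empty_or_nonempty with rfl | hI
  · exact convertible_neqKernel_false (by positivity) (by simp)
  have hm : (1 : ℝ) ≤ I.card := by exact_mod_cast hI.card_pos
  obtain ⟨u, hu⟩ : ∃ u : ℝ, u = (I.card : ℝ) ^ (1 / 6 : ℝ) := ⟨_, rfl⟩
  rw [← hu]
  have hu1 : 1 ≤ u := hu ▸ Real.one_le_rpow hm (by norm_num)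
  have hu6 : (I.card : ℝ) = u ^ 6 := by
    rw [hu, ← Real.rpow_natCast, ← Real.rpow_mul (by positivity)]
    norm_num
  have hr : (⌊u ^ 4 / 2⌋₊ : ℝ) ≤ u ^ 4 / 2 := Nat.floor_le (by positivity)
  have hr' : u ^ 4 / 2 < ⌊u ^ 4 / 2⌋₊ + 1 := Nat.lt_floor_add_one _
  have h46 : u ^ 4 ≤ u ^ 6 := pow_le_pow_right₀ hu1 (by norm_num)
  have hrI : 2 * ⌊u ^ 4 / 2⌋₊ ≤ I.card := by
    have : (2 * ⌊u ^ 4 / 2⌋₊ : ℝ) ≤ I.card := by linarith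
    exact_mod_cast this
  have hIn : (I.card : ℝ) ≤ n := by exact_mod_cast (Finset.card_le_univ I).trans (by simp)
  obtain ⟨i, _⟩ := hI
  have := convertible_exists_isWrong (n := n) val I Finset.univ ⌊u ^ 4 / 2⌋₊ hrI ⟨i, ‹_›⟩
    ⟨i, Finset.mem_univ i⟩
  simp only [Finset.mem_univ, true_and] at this
  exact this.mono fun _ => learningGraph_cost_le (by positivity) hu1 hu6 hIn (by simp)
    (by linarith) (by linarith)

/-- The case `r = 0` with a single row: in effect a Grover search over columns with checks of cost
`O(n)`. -/
theorem convertible_wrongColumn (val : Γ → R) (i : Fin n) (J : Finset (Fin n)) :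
    Convertible (Q := Position n) (Γ := Γ) (fun _ => 3 * n * (J.card : ℝ) ^ (1 / 2 : ℝ))
      (neqKernel fun x => ∃ j ∈ J, IsWrong val x i j) := by
  rcases J.eq_empty_or_nonempty with rfl | hJ
  · exact convertible_neqKernel_false (by positivity) (by simp)
  have := convertible_exists_isWrong (n := n) val {i} J 0 (by simp) (by simp) hJ
  simp only [Finset.mem_singleton, exists_eq_left] at this
  refine this.mono fun _ => ?_
  rw [← Real.sqrt_eq_rpow]
  have : (1 : ℝ) ≤ √J.card := Real.one_le_sqrt.2 (by exact_mod_cast hJ.card_pos)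
  have : (n : ℝ) * 1 ≤ n * √J.card := by gcongr
  simp
  linarith

end Label

theorem exists_convertible_label : ∃ C : ℝ, 0 < C ∧ ∀ n : ℕ, 1 ≤ n →
    ∀ (R : Type*) [Semiring R] (Γ : Type*) [Fintype Γ] (val : Γ → R),
      ∃ i j : (Position n → Γ) → Fin n,
        (∀ x, (∃ i j, IsWrong val x i j) → IsWrong val x (i x) (j x)) ∧
        Convertible (fun _ => C * (n : ℝ) ^ (5 / 3 : ℝ))
          (neqKernel fun x => (∃ i j, IsWrong val x i j, i x, j x)) := by
  set q : ℝ → ℝ := fun α => (2 / 3 : ℝ) ^ α / (1 - (2 / 3 : ℝ) ^ α) with hq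
  have hq0 : ∀ α, 0 < α → 0 < q α := by
    intro α hα
    have : (2 / 3 : ℝ) ^ α < 1 := Real.rpow_lt_one (by norm_num) (by norm_num) hα
    exact div_pos (by positivity) (by linarith)
  have hq1 := hq0 (1 / 6) (by norm_num)
  have hq2 := hq0 (1 / 2) (by norm_num)
  refine ⟨5 + q (1 / 6) * 5 + q (1 / 2) * 3, by positivity, ?_⟩
  intro n hn R _ Γ _ val
  have hn1 : (1 : ℝ) ≤ n := by exact_mod_cast hn
  have hne : (Finset.univ : Finset (Fin n)).Nonempty := ⟨⟨0, hn⟩, Finset.mem_univ _⟩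
  obtain ⟨i, -, hi, hiconv⟩ := Convertible.find (Q := Position n) (Γ := Γ)
    (fun i x => ∃ j, IsWrong val x i j) (by positivity) (by norm_num)
    (convertible_wrongRow val) Finset.univ hne
  choose j _ hj hjconv using fun i => Convertible.find (Q := Position n) (Γ := Γ)
    (fun j x => IsWrong val x i j) (by positivity) (by norm_num)
    (convertible_wrongColumn val i) Finset.univ hne
  have hd := convertible_wrongRow (Γ := Γ) val (Finset.univ : Finset (Fin n))
  simp only [Finset.mem_univ, true_and, Finset.card_univ,
    Fintype.card_fin] at hi hj hiconv hjconv hd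
  refine ⟨i, fun x => j (i x) x, fun x hx => hj _ x (hi x hx), ?_⟩
  -- The decision is kept in the label because the searches return indices even when `A * B = C`.
  refine (hd.pair fun _ => hiconv.pair hjconv).mono fun x => ?_
  have e1 : (n : ℝ) * √n * (n : ℝ) ^ (1 / 6 : ℝ) = (n : ℝ) ^ (5 / 3 : ℝ) := by
    rw [Real.sqrt_eq_rpow, ← Real.rpow_one_add' (by positivity) (by norm_num),
      ← Real.rpow_add (by positivity)]
    norm_num
  have e2 : (n : ℝ) * (n : ℝ) ^ (1 / 2 : ℝ) ≤ (n : ℝ) ^ (5 / 3 : ℝ) := by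
    rw [← Real.rpow_one_add' (by positivity) (by norm_num)]
    exact Real.rpow_le_rpow_of_exponent_le hn1 (by norm_num)
  calc 5 * (n * √n) * (n : ℝ) ^ (1 / 6 : ℝ)
        + (q (1 / 6) * (5 * (n * √n)) * (n : ℝ) ^ (1 / 6 : ℝ)
          + q (1 / 2) * (3 * n) * (n : ℝ) ^ (1 / 2 : ℝ))
      = (5 + q (1 / 6) * 5) * (n * √n * (n : ℝ) ^ (1 / 6 : ℝ))
        + q (1 / 2) * 3 * (n * (n : ℝ) ^ (1 / 2 : ℝ)) := by ring
    _ ≤ (5 + q (1 / 6) * 5) * (n : ℝ) ^ (5 / 3 : ℝ)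
        + q (1 / 2) * 3 * (n : ℝ) ^ (5 / 3 : ℝ) := by
      rw [e1]
      gcongr
    _ = _ := by ring

end MatrixProductVerification

theorem theorem6 :
    ∀ ε : ℝ, 0 < ε → ∃ K : ℝ, ∀ n : ℕ, 1 ≤ n →
      ∀ (R : Type*) [Semiring R] (Γ : Type*) [Fintype Γ] [AddCommGroup Γ] (val : Γ → R),
        ∃ alg : QuantumQuery.Algorithm (MatrixProductVerification.Position n) Γ
            (Option (Fin n × Fin n)),
          (alg.queries : ℝ) ≤ K * (n : ℝ) ^ (5 / 3 : ℝ) ∧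
          ∀ A B C : Matrix (Fin n) (Fin n) Γ,
            1 - ε ≤ alg.successProb (MatrixProductVerification.input A B C)
              (MatrixProductVerification.IsCorrect (A.map val) (B.map val) (C.map val)) := by
  intro ε hε
  obtain ⟨c, hc, hlabel⟩ := MatrixProductVerification.exists_convertible_label
  -- Taking `4 * W / ε` queries brings the error `4 * W / K` down to `ε`; the `+ 1` absorbs the
  -- rounding, as `n ^ (5/3) ≥ 1`.
  refine ⟨4 * c / ε + 1, ?_⟩
  intro n hn R _ Γ _ _ val
  obtain ⟨i, j, hij, hconv⟩ := hlabel n hn R Γ val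
  have hn1 : (1 : ℝ) ≤ (n : ℝ) ^ (5 / 3 : ℝ) :=
    Real.one_le_rpow (by exact_mod_cast hn) (by norm_num)
  set W : ℝ := c * (n : ℝ) ^ (5 / 3 : ℝ) with hW
  have hW0 : 0 < 4 * W / ε := by positivity
  have hK : 0 < ⌈4 * W / ε⌉₊ := Nat.ceil_pos.2 hW0
  have : Nonempty (MatrixProductVerification.Position n) := ⟨0, ⟨0, hn⟩, ⟨0, hn⟩⟩
  obtain ⟨alg, hq, halg⟩ := hconv.exists_algorithm MatrixProductVerification.answer hK
  refine ⟨alg, ?_, fun A B C => le_trans ?_ (halg _ _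
    (MatrixProductVerification.isCorrect_answer val A B C _ _ (hij _)))⟩
  · rw [hq]
    calc (⌈4 * W / ε⌉₊ : ℝ) ≤ 4 * W / ε + 1 := (Nat.ceil_lt_add_one hW0.le).le
      _ ≤ 4 * W / ε + (n : ℝ) ^ (5 / 3 : ℝ) := by gcongr
      _ = (4 * c / ε + 1) * (n : ℝ) ^ (5 / 3 : ℝ) := by rw [hW]; ring
  · have h1 : 4 * W / ε ≤ ⌈4 * W / ε⌉₊ := Nat.le_ceil _
    have h2 : 4 * W / ⌈4 * W / ε⌉₊ ≤ ε := by
      rw [div_le_iff₀ (by positivity)]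
      rw [div_le_iff₀ hε] at h1
      linarith
    linarith
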